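/- A real-valued logarithmic derivative of degree $m\ge 1$ is a rational function $\rho(x)=\frac{P'(x)}{P(x)}=\sum_{k=1}^{m}\frac1{x-z_k}$, where $P(x)=\prod_{k=1}^m (x-z_k)$, $z_k\in\mathbb{C}$ (repetitions allowed), which takes real values at all real $x$ other than the $z_k$. For $n\ge 1$ and $a\in\mathbb{R}$ let $\mathfrak{R}_n(a)$ be the set of all real-valued logarithmic derivatives of degree at most $n$ that have a pole at $a$ (that is, some $z_k=a$). Put $I=[-1,1]$ and $$\|\rho\|^*=\sup_{x\in I}\bigl|\sqrt{1-x^2}\,\rho(x)\bigr|\in[0,\infty]$$ (the supremum is a maximum if $\rho$ has no pole on $I$, and $\|\rho\|^*=\infty$ otherwise). Let $T_n$ and $U_n$ be the Chebyshev polynomials of the first and of the second kind. Theorem. Let $n\ge 1$ and $a>\sqrt2$. The function $$\tilde\rho^*_n(a;x)=\frac{U_{n-1}(x)}{\int_a^x U_{n-1}(t)\,dt}=\frac{n\,U_{n-1}(x)}{T_n(x)-T_n(a)}$$ belongs to $\mathfrak{R}_n(a)$ and is least deviating from zero on $I$ in the norm $\|\cdot\|^*$ among all elements of $\mathfrak{R}_n(a)$: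 one has $\|\tilde\rho^*_n(a;\cdot)\|^*\le\|\rho\|^*$ for every $\rho\in\mathfrak{R}_n(a)$. Moreover, its norm is a maximum that is attained on $I$, and $$\|\tilde\rho^*_n(a;\cdot)\|^*=\frac{n}{\sqrt{T_n(a)^2-1}}.$$ -/

import Mathlib

open scoped ENNReal

noncomputable section

/-- The logarithmic derivative `P'(z) / P(z) = ∑ 1 / (z - w)` of the monic polynomial
`P(z) = ∏ (z - w)`, where `w` runs over the multiset `Z` of its roots.
It is meaningful for `z ∉ Z`; the degree of the logarithmic derivative is `Z.card`. -/
def logDerivOfPoles (Z : Multiset ℂ) (z : ℂ) : ℂ :=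
  (Z.map fun w => 1 / (z - w)).sum

theorem logDerivOfPoles_eq (Z : Multiset ℂ) (z : ℂ) (hz : z ∉ Z) :
    logDerivOfPoles Z z =
      (Polynomial.derivative (Z.map fun w => Polynomial.X - Polynomial.C w).prod).eval z /
        ((Z.map fun w => Polynomial.X - Polynomial.C w).prod).eval z := by
  have hroots : ((Z.map fun w => Polynomial.X - Polynomial.C w).prod).roots = Z :=
    Polynomial.roots_multiset_prod_X_sub_C Z
  have hmonic : ((Z.map fun w => Polynomial.X - Polynomial.C w).prod).Monic :=
    Polynomial.monic_multisetProd_X_sub_C Z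
  have hne : ((Z.map fun w => Polynomial.X - Polynomial.C w).prod).eval z ≠ 0 := by
    intro h
    apply hz
    rw [← hroots]
    exact (Polynomial.mem_roots hmonic.ne_zero).2 h
  rw [Polynomial.Splits.eval_derivative_div_eval_of_ne_zero
    (IsAlgClosed.splits _) hne, hroots]
  rfl

/-- The class of real-valued logarithmic derivatives of degree at most `n` having a pole at the
real point `a`. Its members are regarded as functions of a real variable, which are subject to
the defining equation away from the poles; real-valuedness on the real line is imposed by the
codomain `ℝ`. -/
def realLogDerivs (n : ℕ) (a : ℝ) : Set (ℝ → ℝ) :=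
  {ρ | ∃ Z : Multiset ℂ, Z.card ≤ n ∧ (a : ℂ) ∈ Z ∧
    ∀ x : ℝ, (x : ℂ) ∉ Z → (ρ x : ℂ) = logDerivOfPoles Z (x : ℂ)}

/-- The weighted uniform norm `sup |√(1 - x²) ρ(x)|` over `[-1, 1]`, with values in `[0, ∞]`.
For a logarithmic derivative with a pole on `[-1, 1]` it is `∞`, because the values near the pole
are unbounded (whatever value `ρ` is given at the pole). -/
def weightedNorm (ρ : ℝ → ℝ) : ℝ≥0∞ :=
  ⨆ x ∈ Set.Icc (-1 : ℝ) 1, ENNReal.ofReal |√(1 - x ^ 2) * ρ x|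

/-- The function `n U_{n-1}(x) / (T_n(x) - T_n(a))`. -/
def extremalLogDeriv (n : ℕ) (a : ℝ) (x : ℝ) : ℝ :=
  n * (Polynomial.Chebyshev.U ℝ ((n : ℤ) - 1)).eval x /
    ((Polynomial.Chebyshev.T ℝ (n : ℤ)).eval x - (Polynomial.Chebyshev.T ℝ (n : ℤ)).eval a)

end

/-! Write `a = cosh t`; the bound `√2 < a` gives `1 ≤ sinh t`. By duality, the lower bound comes
from a quadrature formula with nodes `x_k = cos θ_k`, where `cos (nθ_k) = 1 / cosh (nt)` and `sin
(nθ_k) = tanh (nt)`; at these points the extremal function attains its weighted maximum. For every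
polynomial `P` of degree at most `n`, `P(a) = ∑ w_k (P(x_k) + (sinh (nt) / n) sin θ_k P'(x_k))` with
`∑ w_k = 1` (`eval_cosh_eq_sum_chebWeight`).

Let `ρ = P'/P` have weighted norm below `n / sinh (nt)`. Each bracket is `P(x_k)` times a positive
number, since `|sin θ_k ρ(x_k)| < n / sinh (nt)`. Because `ρ` is real and has no pole on the
interval, `P` has constant phase there. If all `w_k ≥ 0`, the right side is therefore nonzero,
contradicting `P(a) = 0` (`exists_le_abs_sqrt_mul_of_pole`).

The delicate point is `w_k ≥ 0` (`chebWeight_nonneg`), the only place where `1 ≤ sinh t` is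
essential. The weight is an explicit sine sum, bounded below by integrating in `t` a sum that has a
closed form. -/

/-! ### Trigonometric and hyperbolic inequalities behind the positivity of the weights -/

open Real Finset in
/-- Closed form of the `s`-derivative of `∑ sinh (j s) / j * sin (j θ)`. -/
theorem two_mul_cosh_sub_cos_mul_sum (n : ℕ) (s θ : ℝ) :
    2 * (cosh s - cos θ) * ∑ j ∈ range n, cosh (j * s) * sin (j * θ) =
      sin θ * (1 - cos (n * θ) * cosh (n * s)) + sinh s * sin (n * θ) * sinh (n * s) -
        (cosh s - cos θ) * sin (n * θ) * cosh (n * s) := by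
  induction n with
  | zero => simp
  | succ n ih =>
    rw [sum_range_succ, mul_add, ih]
    push_cast
    rw [add_one_mul, add_one_mul, sin_add, cos_add, cosh_add, sinh_add]
    have h1 := sin_sq_add_cos_sq θ
    have h2 := cosh_sq s
    linear_combination
      (-sin (n * θ) * cosh (n * s) * cosh s - sin (n * θ) * sinh (n * s) * sinh s) * h1 +
      (sin (n * θ) * cosh (n * s) * cos θ + cos (n * θ) * cosh (n * s) * sin θ) * h2

open Real Finset in
theorem hasDerivAt_sum_sinh_div_mul_sin (n : ℕ) (s θ : ℝ) :
    HasDerivAt (fun s => ∑ j ∈ range n, sinh (j * s) / j * sin (j * θ))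
      (∑ j ∈ range n, cosh (j * s) * sin (j * θ)) s := by
  refine HasDerivAt.fun_sum fun j _ => ?_
  rcases Nat.eq_zero_or_pos j with rfl | hj
  -- The `j = 0` summand is identically zero, division by zero included, and so is its claimed
  -- derivative, because `sin 0 = 0`.
  · simpa using hasDerivAt_const s (0 : ℝ)
  · have hj' : (j : ℝ) ≠ 0 := by positivity
    have := ((((hasDerivAt_id s).const_mul (j : ℝ)).sinh).div_const (j : ℝ)).mul_const (sin (j * θ))
    refine this.congr_deriv ?_
    rw [mul_one, mul_div_cancel_right₀ _ hj']
    rfl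

open Real in
theorem cosh_pow_le_cosh_mul {t : ℝ} (ht : 0 ≤ t) (n : ℕ) : cosh t ^ n ≤ cosh (n * t) := by
  induction n with
  | zero => simp
  | succ n ih =>
    push_cast
    rw [add_one_mul, cosh_add, pow_succ]
    have h1 : 0 ≤ sinh (n * t) := sinh_nonneg_iff.2 (by positivity)
    have h2 : 0 ≤ sinh t := sinh_nonneg_iff.2 ht
    nlinarith [mul_le_mul_of_nonneg_right ih (cosh_pos t).le, mul_nonneg h1 h2]

open Real in
theorem mul_sinh_mul_cosh_pow_le {t : ℝ} (ht : 0 ≤ t) (n : ℕ) :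
    (n + 1) * sinh t * cosh t ^ n ≤ sinh ((n + 1) * t) := by
  induction n with
  | zero => simp
  | succ n ih =>
    push_cast
    rw [add_one_mul ((n : ℝ) + 1) t, sinh_add, pow_succ]
    have h2 : 0 ≤ sinh t := sinh_nonneg_iff.2 ht
    have h3 := cosh_pow_le_cosh_mul ht (n + 1)
    push_cast at h3
    rw [pow_succ] at h3
    nlinarith [mul_le_mul_of_nonneg_right ih (cosh_pos t).le, mul_le_mul_of_nonneg_right h3 h2]

-- With `y = x / 2` this is `y ≤ tan y`, cleared of denominators so that it also covers `x = π`.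
open Real in
theorem sin_mul_le_two_mul_one_sub_cos {x : ℝ} (h0 : 0 ≤ x) (h1 : x ≤ π) :
    x * sin x ≤ 2 * (1 - cos x) := by
  have h2 : x / 2 * cos (x / 2) ≤ sin (x / 2) := by
    rcases h1.lt_or_eq with h | rfl
    · have hc : 0 < cos (x / 2) := cos_pos_of_mem_Ioo ⟨by linarith [pi_pos], by linarith⟩
      have := le_tan (by linarith : 0 ≤ x / 2) (by linarith)
      rw [tan_eq_sin_div_cos, le_div_iff₀ hc] at this
      exact this
    · simp
  have hs : 0 ≤ sin (x / 2) := sin_nonneg_of_nonneg_of_le_pi (by linarith) (by linarith)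
  have e1 : sin x = 2 * sin (x / 2) * cos (x / 2) := by rw [← sin_two_mul]; ring_nf
  have e2 : cos x = 1 - 2 * sin (x / 2) ^ 2 := by
    have := cos_two_mul (x / 2)
    rw [cos_sq'] at this
    rw [show x = 2 * (x / 2) by ring, this]; ring_nf
  rw [e1, e2]
  nlinarith

open Real in
/-- The estimate that uses `1 ≤ sinh t`. -/
theorem mul_cosh_sub_cos_le {n : ℕ} {t η : ℝ} (ht : 0 ≤ t) (hs : 1 ≤ sinh t)
    (h0 : 3 * π / 2 ≤ n * η) (h1 : η < π) :
    n * (sin η * (cosh t - cos η)) ≤ sinh (n * t) * (1 - cos η) := by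
  have hη : 0 < η := by
    by_contra h
    nlinarith [pi_pos, mul_nonneg (Nat.cast_nonneg (α := ℝ) n) (sub_nonneg.2 (not_lt.1 h))]
  have hn2 : 2 ≤ n := by
    by_contra h
    have : (n : ℝ) ≤ 1 := by exact_mod_cast (by omega : n ≤ 1)
    nlinarith [pi_pos]
  obtain ⟨k, rfl⟩ := Nat.exists_eq_add_of_le' hn2
  have hS := mul_sinh_mul_cosh_pow_le ht (k + 1)
  have hB := one_add_mul_le_pow (by linarith [one_le_cosh t] : -2 ≤ cosh t - 1) k
  rw [add_sub_cancel] at hB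
  set u := cosh t with hu
  have hu1 : 1 ≤ u := one_le_cosh t
  have hsin : 0 ≤ sin η := sin_nonneg_of_nonneg_of_le_pi hη.le h1.le
  have hsin1 := sin_le_one η
  have hcos1 : 0 < 1 - cos η := by
    have : cos η < cos 0 := cos_lt_cos_of_nonneg_of_le_pi le_rfl h1.le hη
    rw [cos_zero] at this; linarith
  push_cast at hS h0 ⊢
  rw [show (k : ℝ) + 1 + 1 = k + 2 by ring] at hS
  have hk : (0 : ℝ) ≤ k := k.cast_nonneg
  -- Bernoulli's inequality bounds `u ^ k` from below, and `1 ≤ sinh t` removes the factor `sinh t`.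
  have hS' : (k + 2) * (u * (1 + k * (u - 1))) ≤ sinh ((k + 2) * t) := by
    refine le_trans ?_ hS
    rw [pow_succ]
    have h3 : u * (1 + k * (u - 1)) ≤ u ^ k * u := by nlinarith
    have h4 : 0 ≤ u ^ k * u := by positivity
    calc (k + 2) * (u * (1 + k * (u - 1))) ≤ (k + 2) * (u ^ k * u) := by gcongr
      _ = (k + 2) * 1 * (u ^ k * u) := by ring
      _ ≤ _ := by gcongr
  have key : sin η * (u - cos η) ≤ u * (1 + k * (u - 1)) * (1 - cos η) := by
    rcases le_or_gt (cos η) 0 with hc | hc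
    · have : u * (1 - cos η) ≤ u * (1 + k * (u - 1)) * (1 - cos η) := by
        have : 0 ≤ k * (u - 1) := mul_nonneg hk (by linarith)
        gcongr
        nlinarith
      nlinarith
    -- For such `η` the factor `1 - cos η` may be small, but `3π/2 ≤ (k + 2) η` then forces `k ≥ 2`,
    -- and `4 < 3π/2` yields `sin η ≤ k (1 - cos η)`.
    · have hη2 : η < π / 2 := by
        by_contra h
        exact absurd (cos_nonpos_of_pi_div_two_le_of_le (not_lt.1 h) (by linarith)) (not_le.2 hc)
      have hk2 : (2 : ℝ) ≤ k := by
        have : (1 : ℝ) < k := by nlinarith [pi_pos]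
        exact_mod_cast this
      have h3 := sin_mul_le_two_mul_one_sub_cos hη.le h1.le
      have h4 : 4 ≤ (k + 2) * η := by linarith [pi_gt_three]
      have h5 : sin η ≤ k * (1 - cos η) := by
        have : 4 * sin η ≤ (k + 2) * (2 * (1 - cos η)) := by
          calc 4 * sin η ≤ (k + 2) * η * sin η := by gcongr
            _ = (k + 2) * (η * sin η) := by ring
            _ ≤ _ := by gcongr
        nlinarith
      have h6 : 0 ≤ k * (u - 1) := mul_nonneg hk (by linarith)
      have h7 : 1 + k * (u - 1) ≤ u * (1 + k * (u - 1)) := by nlinarith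
      calc sin η * (u - cos η) = sin η * (1 - cos η) + sin η * (u - 1) := by ring
        _ ≤ 1 * (1 - cos η) + k * (1 - cos η) * (u - 1) := by
            gcongr
        _ = (1 + k * (u - 1)) * (1 - cos η) := by ring
        _ ≤ _ := by gcongr
  calc (k + 2) * (sin η * (u - cos η)) ≤ (k + 2) * (u * (1 + k * (u - 1)) * (1 - cos η)) := by
        gcongr
    _ = (k + 2) * (u * (1 + k * (u - 1))) * (1 - cos η) := by ring
    _ ≤ _ := by gcongr

-- The quantity is the value at `t` of a function `Ψ` that vanishes at `0` and is shown to be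
-- monotone. The term of `Ψ` with `K` vanishes at both ends; its role is to offset a negative `sin
-- θ` in `Ψ'`.
open Real Finset in
theorem sum_sinh_div_mul_sin_lower_bound {n : ℕ} (hn : n ≠ 0) {t θ K : ℝ} (ht : 0 < t)
    (hcos : cosh (n * t) * cos (n * θ) = 1)
    (hsin : cosh (n * t) * sin (n * θ) = sinh (n * t))
    (hK : 0 ≤ K) (hK1 : 0 ≤ sin θ + K * (1 - cos θ))
    (hK2 : n * K * (cosh t - cos θ) ≤ sinh (n * t)) :
    0 ≤ 2 * cosh (n * t) * ∑ j ∈ range n, sinh (j * t) / j * sin (j * θ) +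
      sinh (n * t) ^ 2 / n := by
  have hn0 : (0 : ℝ) < n := by positivity
  set c := cosh (n * t) with hc
  set S := sinh (n * t) with hS
  let F' : ℝ → ℝ := fun s => ∑ j ∈ range n, cosh (j * s) * sin (j * θ)
  let Ψ : ℝ → ℝ := fun s => 2 * c * (∑ j ∈ range n, sinh (j * s) / j * sin (j * θ)) +
    S * sinh (n * s) / n + (c - cosh (n * s)) * (K * s)
  have hd : ∀ s, HasDerivAt Ψ (2 * c * F' s + S * cosh (n * s) + ((c - cosh (n * s)) * K -
      n * sinh (n * s) * (K * s))) s := by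
    intro s
    have h1 := (hasDerivAt_sum_sinh_div_mul_sin n s θ).const_mul (2 * c)
    have hl := (hasDerivAt_id s).const_mul (n : ℝ)
    have h2 := ((hl.sinh).const_mul S).div_const (n : ℝ)
    have h3 := ((hl.cosh).const_sub c).mul ((hasDerivAt_id s).const_mul K)
    refine ((h1.add h2).add h3).congr_deriv ?_
    simp only [id, F']
    generalize ∑ j ∈ range n, cosh (j * s) * sin (j * θ) = A
    field_simp
    ring
  have hmono : MonotoneOn Ψ (Set.Icc 0 t) := by
    refine monotoneOn_of_deriv_nonneg (convex_Icc 0 t)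
      (fun s _ => (hd s).continuousAt.continuousWithinAt)
      (fun s _ => (hd s).differentiableAt.differentiableWithinAt) fun s hs => ?_
    rw [interior_Icc] at hs
    obtain ⟨hs0, hst⟩ := hs
    rw [(hd s).deriv]
    have hD : 0 < cosh s - cos θ := by linarith [one_lt_cosh.2 hs0.ne', cos_le_one θ]
    have hF := two_mul_cosh_sub_cos_mul_sum n s θ
    have hv : 0 ≤ c - cosh (n * s) := by
      rw [sub_nonneg, hc, cosh_le_cosh, abs_of_nonneg (by positivity), abs_of_nonneg (by positivity)]
      gcongr
    have hsn : 0 ≤ sinh (n * s) := sinh_nonneg_iff.2 (by positivity)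
    have hDt : cosh s - cos θ ≤ cosh t - cos θ := by
      gcongr
      rw [cosh_le_cosh, abs_of_pos hs0, abs_of_pos ht]; exact hst.le
    have h1 : n * K * (cosh s - cos θ) * s ≤ S * sinh s := by
      have h2 : s ≤ sinh s := self_le_sinh_iff.2 hs0.le
      have h3 : n * K * (cosh s - cos θ) ≤ S := le_trans (by gcongr) hK2
      have h4 : 0 ≤ n * K * (cosh s - cos θ) := by positivity
      exact mul_le_mul h3 h2 hs0.le (h4.trans h3)
    have h2 : 0 ≤ sin θ + K * (cosh s - cos θ) := by
      nlinarith [one_le_cosh s]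
    -- Multiplication by `cosh s - cos θ` brings in the closed form of the sum. The node equations
    -- `hcos` and `hsin` then split the result into two products of nonnegative factors.
    refine nonneg_of_mul_nonneg_right (a := cosh s - cos θ) ?_ hD
    have e : (cosh s - cos θ) * (2 * c * F' s + S * cosh (n * s) + ((c - cosh (n * s)) * K -
        n * sinh (n * s) * (K * s))) = (sin θ + K * (cosh s - cos θ)) * (c - cosh (n * s)) +
        sinh (n * s) * (S * sinh s - n * K * (cosh s - cos θ) * s) := by
      linear_combination c * hF - sin θ * cosh (n * s) * hcos + (sinh s * sinh (n * s) -
        (cosh s - cos θ) * cosh (n * s)) * hsin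
    rw [e]
    exact add_nonneg (mul_nonneg h2 hv) (mul_nonneg hsn (by linarith))
  have := hmono (Set.left_mem_Icc.2 ht.le) (Set.right_mem_Icc.2 ht.le) ht.le
  simp only [Ψ, mul_zero, sinh_zero, zero_div, zero_mul, sum_const_zero, add_zero, ← hc, ← hS,
    sub_self] at this
  rwa [sq]

/-! ### Nodes, the sign of the sine sum at them, and discrete orthogonality -/

open Real in
/-- The nodes `(φ + 2πk) / n`, `k < n`, where `cos φ = 1 / cosh (n t)`. -/
noncomputable def chebNode (n : ℕ) (t : ℝ) (k : ℕ) : ℝ :=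
  (arccos (1 / cosh (n * t)) + 2 * π * k) / n

open Real in
theorem mul_chebNode {n : ℕ} (hn : n ≠ 0) (t : ℝ) (k : ℕ) :
    n * chebNode n t k = arccos (1 / cosh (n * t)) + k * (2 * π) := by
  rw [chebNode, mul_div_cancel₀ _ (by positivity)]; ring

open Real in
theorem cosh_mul_cos_chebNode {n : ℕ} (hn : n ≠ 0) (t : ℝ) (k : ℕ) :
    cosh (n * t) * cos (n * chebNode n t k) = 1 := by
  have h1 := one_le_cosh (n * t)
  rw [mul_chebNode hn, cos_add_nat_mul_two_pi, cos_arccos, mul_one_div_cancel (by positivity)]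
  · have : 0 < 1 / cosh (n * t) := by positivity
    linarith
  · rwa [div_le_one (by positivity)]

open Real in
theorem cosh_mul_sin_chebNode {n : ℕ} (hn : n ≠ 0) {t : ℝ} (ht : 0 ≤ t) (k : ℕ) :
    cosh (n * t) * sin (n * chebNode n t k) = sinh (n * t) := by
  have h1 := cosh_pos (n * t)
  have h2 : 0 ≤ sinh (n * t) := sinh_nonneg_iff.2 (by positivity)
  rw [mul_chebNode hn, sin_add_nat_mul_two_pi, sin_arccos,
    show 1 - (1 / cosh (n * t)) ^ 2 = (sinh (n * t) / cosh (n * t)) ^ 2 by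
      rw [div_pow, div_pow, sinh_sq]; field_simp, sqrt_sq (by positivity)]
  field_simp

open Real Finset in
theorem chebNode_sum_nonneg {n : ℕ} (hn : n ≠ 0) {t : ℝ} (ht : 0 ≤ t) (hs : 1 ≤ sinh t) {k : ℕ}
    (hk : k < n) :
    0 ≤ 2 * cosh (n * t) * ∑ j ∈ range n, sinh (j * t) / j * sin (j * chebNode n t k) +
      sinh (n * t) ^ 2 / n := by
  have ht0 : 0 < t := ht.lt_of_ne (by rintro rfl; simp at hs; linarith)
  have hS : 0 ≤ sinh (n * t) := sinh_nonneg_iff.2 (by positivity)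
  set θ := chebNode n t k with hθ
  have hcos := cosh_mul_cos_chebNode hn t k
  have hsin := cosh_mul_sin_chebNode hn ht k
  rcases le_or_gt 0 (sin θ) with h | h
  · exact sum_sinh_div_mul_sin_lower_bound hn ht0 hcos hsin le_rfl (by simpa using h)
      (by simpa using hS)
  · have hφ0 : 0 ≤ arccos (1 / cosh (n * t)) := arccos_nonneg _
    have hφ : arccos (1 / cosh (n * t)) ≤ π / 2 :=
      arccos_le_pi_div_two.2 (by have := cosh_pos (n * t); positivity)
    have hnθ := mul_chebNode hn t k
    rw [← hθ] at hnθ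
    have hn' : (0 : ℝ) < n := by positivity
    have hkn : (k : ℝ) + 1 ≤ n := by exact_mod_cast hk
    -- Since `k ≤ n - 1`, `nθ ≤ π/2 + 2π(n - 1)`.
    have hη : 3 * π / 2 ≤ n * (2 * π - θ) := by nlinarith [pi_pos]
    have hθπ : π < θ := by
      by_contra h'
      have : 0 ≤ θ := by rw [hθ, chebNode]; positivity
      exact absurd (sin_nonneg_of_nonneg_of_le_pi this (not_lt.1 h')) (not_le.2 h)
    have key := mul_cosh_sub_cos_le ht hs hη (by linarith)
    rw [sin_two_pi_sub, cos_two_pi_sub] at key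
    have hc : 0 < 1 - cos θ := by
      have : cos θ ≠ 1 := by
        intro h1
        have := sin_sq_add_cos_sq θ
        rw [h1] at this
        nlinarith
      have := lt_of_le_of_ne (cos_le_one θ) this
      linarith
    -- The smallest `K` with `0 ≤ sin θ + K (1 - cos θ)`, hence the one for which the upper bound on
    -- `K` is easiest.
    refine sum_sinh_div_mul_sin_lower_bound hn ht0 hcos hsin (K := -sin θ / (1 - cos θ))
      (div_nonneg (by linarith) hc.le) ?_ ?_
    · rw [div_mul_cancel₀ _ hc.ne']; simp
    · rw [mul_div_assoc', div_mul_eq_mul_div, div_le_iff₀ hc]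
      linarith

-- The nodes are equally spaced by `2π / n`, so this is a geometric sum whose ratio is an `n`-th
-- root of unity other than `1`.
open Real Finset in
theorem sum_cexp_chebNode_eq_zero {n : ℕ} (hn : n ≠ 0) (t : ℝ) {m : ℤ} (hm : ¬ (n : ℤ) ∣ m) :
    ∑ k ∈ range n, Complex.exp ((m * chebNode n t k : ℝ) * Complex.I) = 0 := by
  have hn' : (n : ℂ) ≠ 0 := by exact_mod_cast hn
  set z : ℂ := Complex.exp (2 * π * Complex.I * (m / n)) with hz
  have hz1 : z ≠ 1 := by
    intro h
    obtain ⟨l, hl⟩ := Complex.exp_eq_one_iff.1 h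
    rw [mul_comm (l : ℂ)] at hl
    have h2 := mul_left_cancel₀ Complex.two_pi_I_ne_zero hl
    rw [div_eq_iff hn'] at h2
    exact hm ⟨l, by rw [mul_comm]; exact_mod_cast h2⟩
  have hzn : z ^ n = 1 := by
    rw [hz, ← Complex.exp_nat_mul, Complex.exp_eq_one_iff]
    exact ⟨m, by field_simp⟩
  have : ∀ k ∈ range n, Complex.exp ((m * chebNode n t k : ℝ) * Complex.I) =
      Complex.exp ((m * (arccos (1 / cosh (n * t)) / n) : ℝ) * Complex.I) * z ^ k := by
    intro k _
    rw [hz, ← Complex.exp_nat_mul, ← Complex.exp_add]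
    congr 1
    rw [chebNode]
    push_cast
    ring
  rw [sum_congr rfl this, ← mul_sum, geom_sum_eq hz1, hzn, sub_self, zero_div, mul_zero]

open Real Finset in
theorem sum_cos_chebNode_eq_zero {n : ℕ} (hn : n ≠ 0) (t : ℝ) {m : ℤ} (hm : ¬ (n : ℤ) ∣ m) :
    ∑ k ∈ range n, cos (m * chebNode n t k) = 0 := by
  have := congrArg Complex.re (sum_cexp_chebNode_eq_zero hn t hm)
  simpa only [Complex.re_sum, Complex.exp_ofReal_mul_I_re, Complex.zero_re] using this

open Real Finset in
theorem sum_sin_chebNode_eq_zero {n : ℕ} (hn : n ≠ 0) (t : ℝ) {m : ℤ} (hm : ¬ (n : ℤ) ∣ m) :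
    ∑ k ∈ range n, sin (m * chebNode n t k) = 0 := by
  have := congrArg Complex.im (sum_cexp_chebNode_eq_zero hn t hm)
  simpa only [Complex.im_sum, Complex.exp_ofReal_mul_I_im, Complex.zero_im] using this

theorem not_natCast_dvd_of_pos_of_lt {n : ℕ} {m : ℤ} (h0 : 0 < m) (h1 : m < n) : ¬ (n : ℤ) ∣ m :=
  fun h => absurd (Int.le_of_dvd h0 h) (not_le.2 h1)

theorem not_natCast_dvd_add {n j m : ℕ} (hj : j < n) (hm : m < n) (h0 : 0 < m) (h : j + m ≠ n) :
    ¬ (n : ℤ) ∣ (j + m : ℤ) := by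
  rintro ⟨l, hl⟩
  have h1 : 0 < l := by by_contra hl'; nlinarith
  have h2 : l < 2 := by by_contra hl'; nlinarith
  obtain rfl : l = 1 := by omega
  omega

theorem not_natCast_dvd_sub {n j m : ℕ} (hj : j < n) (hm : m < n) (h : j ≠ m) :
    ¬ (n : ℤ) ∣ (j - m : ℤ) := by
  rintro ⟨l, hl⟩
  have h1 : -1 < l := by by_contra hl'; nlinarith
  have h2 : l < 1 := by by_contra hl'; nlinarith
  obtain rfl : l = 0 := by omega
  omega

-- The product splits into frequencies `j + m` and `j - m`. The only surviving contribution is the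
-- aliased frequency `j + m = n`, at which the sine takes the same value `tanh (nt)` at every node.
open Real Finset in
theorem sum_sin_mul_cos_chebNode {n : ℕ} (hn : n ≠ 0) {t : ℝ} (ht : 0 ≤ t) {j m : ℕ} (hj : j < n)
    (hm : m < n) (h0 : 0 < m) :
    ∑ k ∈ range n, sin (j * chebNode n t k) * cos (m * chebNode n t k) =
      if j = n - m then n / 2 * (sinh (n * t) / cosh (n * t)) else 0 := by
  have e : ∀ θ : ℝ, sin (j * θ) * cos (m * θ) =
      (sin (((j + m : ℤ) : ℝ) * θ) + sin (((j - m : ℤ) : ℝ) * θ)) / 2 := by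
    intro θ
    push_cast
    rw [add_mul, sub_mul, sin_add, sin_sub]; ring
  simp_rw [e]
  rw [← sum_div, sum_add_distrib]
  have h2 : ∑ k ∈ range n, sin (((j - m : ℤ) : ℝ) * chebNode n t k) = 0 := by
    rcases eq_or_ne j m with rfl | h
    · simp
    · exact sum_sin_chebNode_eq_zero hn t (not_natCast_dvd_sub hj hm h)
  rw [h2, add_zero]
  split_ifs with h
  · have e2 : ∀ k ∈ range n, sin (((j + m : ℤ) : ℝ) * chebNode n t k) =
        sinh (n * t) / cosh (n * t) := by
      intro k _
      rw [show (j + m : ℤ) = n by omega, ← cosh_mul_sin_chebNode hn ht k, Int.cast_natCast,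
        mul_div_cancel_left₀ _ (cosh_pos _).ne']
    rw [sum_congr rfl e2, sum_const, card_range, nsmul_eq_mul]; ring
  · rw [sum_sin_chebNode_eq_zero hn t (not_natCast_dvd_add hj hm h0 (by omega)), zero_div]

open Real Finset in
theorem sum_sin_mul_sin_chebNode {n : ℕ} (hn : n ≠ 0) (t : ℝ) {j m : ℕ} (hj : j < n)
    (hm : m < n) (h0 : 0 < m) :
    ∑ k ∈ range n, sin (j * chebNode n t k) * sin (m * chebNode n t k) =
      (if j = m then (n / 2 : ℝ) else 0) - if j = n - m then n / 2 * (1 / cosh (n * t)) else 0 := by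
  have e : ∀ θ : ℝ, sin (j * θ) * sin (m * θ) =
      (cos (((j - m : ℤ) : ℝ) * θ) - cos (((j + m : ℤ) : ℝ) * θ)) / 2 := by
    intro θ
    push_cast
    rw [add_mul, sub_mul, cos_add, cos_sub]; ring
  simp_rw [e]
  rw [← sum_div, sum_sub_distrib, sub_div]
  congr 1
  · split_ifs with h
    · subst h; simp
    · rw [sum_cos_chebNode_eq_zero hn t (not_natCast_dvd_sub hj hm h), zero_div]
  · split_ifs with h
    · have e2 : ∀ k ∈ range n, cos (((j + m : ℤ) : ℝ) * chebNode n t k) = 1 / cosh (n * t) := by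
        intro k _
        rw [show (j + m : ℤ) = n by omega, ← cosh_mul_cos_chebNode hn t k, Int.cast_natCast,
          mul_div_cancel_left₀ _ (cosh_pos _).ne']
      rw [sum_congr rfl e2, sum_const, card_range, nsmul_eq_mul]; ring
    · rw [sum_cos_chebNode_eq_zero hn t (not_natCast_dvd_add hj hm h0 (by omega)), zero_div]

/-! ### The quadrature formula -/

open Real Finset in
/-- The weights of the quadrature formula at the nodes `chebNode`. -/
noncomputable def chebWeight (n : ℕ) (t : ℝ) (k : ℕ) : ℝ :=
  1 / n + 2 * cosh (n * t) / sinh (n * t) ^ 2 *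
    ∑ j ∈ range n, sinh (j * t) / j * sin (j * chebNode n t k)

open Real Finset in
theorem chebWeight_nonneg {n : ℕ} (hn : n ≠ 0) {t : ℝ} (ht : 0 ≤ t) (hs : 1 ≤ sinh t) {k : ℕ}
    (hk : k < n) : 0 ≤ chebWeight n t k := by
  have ht0 : 0 < t := ht.lt_of_ne (by rintro rfl; simp at hs; linarith)
  have hS : 0 < sinh (n * t) := sinh_pos_iff.2 (by positivity)
  have h := chebNode_sum_nonneg hn ht hs hk
  have e : chebWeight n t k = (2 * cosh (n * t) * ∑ j ∈ range n, sinh (j * t) / j *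
      sin (j * chebNode n t k) + sinh (n * t) ^ 2 / n) / sinh (n * t) ^ 2 := by
    rw [chebWeight]
    generalize ∑ j ∈ range n, sinh (j * t) / j * sin (j * chebNode n t k) = A
    field_simp
    ring
  rw [e]
  positivity

open Real Finset in
theorem sum_chebWeight_mul (n : ℕ) (t : ℝ) (f : ℕ → ℝ) :
    ∑ k ∈ range n, chebWeight n t k * f k = 1 / n * ∑ k ∈ range n, f k +
      2 * cosh (n * t) / sinh (n * t) ^ 2 * ∑ j ∈ range n, sinh (j * t) / j *
        ∑ k ∈ range n, sin (j * chebNode n t k) * f k := by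
  simp_rw [chebWeight, add_mul, sum_add_distrib, mul_sum, sum_mul]
  congr 1
  rw [sum_comm]
  exact sum_congr rfl fun j _ => sum_congr rfl fun k _ => by ring

open Real Finset in
theorem sum_chebWeight_mul_const {n : ℕ} (hn : n ≠ 0) (t : ℝ) (C : ℝ) :
    ∑ k ∈ range n, chebWeight n t k * C = C := by
  rw [sum_chebWeight_mul]
  have : ∀ j ∈ range n, sinh (j * t) / j * ∑ k ∈ range n, sin (j * chebNode n t k) * C = 0 := by
    intro j hj
    rcases Nat.eq_zero_or_pos j with rfl | h
    · simp
    · have := sum_sin_chebNode_eq_zero hn t (m := j)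
        (not_natCast_dvd_of_pos_of_lt (by omega) (by simpa using hj))
      rw [← sum_mul]
      rw [Int.cast_natCast] at this
      rw [this, zero_mul, mul_zero]
  rw [sum_congr rfl this]
  have : (n : ℝ) ≠ 0 := by exact_mod_cast hn
  simp [this]

-- This is the quadrature formula for `P = T_m`, since `sin θ T_m'(cos θ) = m sin (mθ)` and
-- `T_m(cosh t) = cosh (mt)`.
open Real Finset in
theorem sum_chebWeight_mul_cos_add_sin {n : ℕ} (hn : n ≠ 0) {t : ℝ} (ht : 0 < t) {m : ℕ}
    (hm : m ≤ n) :
    ∑ k ∈ range n, chebWeight n t k * (cos (m * chebNode n t k) +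
      sinh (n * t) / n * (m * sin (m * chebNode n t k))) = cosh (m * t) := by
  have hn' : (0 : ℝ) < n := by positivity
  have hS : 0 < sinh (n * t) := sinh_pos_iff.2 (by positivity)
  have hc := cosh_pos (n * t)
  rcases hm.eq_or_lt with rfl | hmn
  -- For `m = n` the bracket is the same at all nodes: `1 / cosh (nt) + sinh² (nt) / cosh (nt) =
  -- cosh (nt)`.
  · have : ∀ k ∈ range m, chebWeight m t k * (cos (m * chebNode m t k) +
        sinh (m * t) / m * (m * sin (m * chebNode m t k))) =
        chebWeight m t k * cosh (m * t) := by
      intro k _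
      congr 1
      have h1 := cosh_mul_cos_chebNode hn t k
      have h2 := cosh_mul_sin_chebNode hn ht.le k
      field_simp
      refine mul_left_cancel₀ hc.ne' ?_
      linear_combination h1 + sinh (m * t) * h2 - cosh_sq (m * t)
    rw [sum_congr rfl this, sum_chebWeight_mul_const hn]
  rcases Nat.eq_zero_or_pos m with rfl | h0
  · simpa using sum_chebWeight_mul_const hn t 1
  rw [sum_chebWeight_mul]
  have hnd := not_natCast_dvd_of_pos_of_lt (n := n) (m := m) (by omega) (by omega)
  have e1 := sum_cos_chebNode_eq_zero hn t hnd
  have e2 := sum_sin_chebNode_eq_zero hn t hnd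
  rw [Int.cast_natCast] at e1 e2
  simp_rw [sum_add_distrib, ← mul_sum]
  rw [e1, e2]
  -- Only `j = m` and `j = n - m` contribute. Their coefficients carry factors `m` and `n - m`,
  -- which cancel the division by `j`; the addition formula for `sinh ((n - m) t)` then combines the
  -- two terms into `cosh (mt)`.
  have e3 : ∀ j ∈ range n, sinh (j * t) / j * ∑ k ∈ range n, sin (j * chebNode n t k) *
      (cos (m * chebNode n t k) + sinh (n * t) / n * (m * sin (m * chebNode n t k))) =
      (if j = n - m then sinh (j * t) / j * (n / 2 * (sinh (n * t) / cosh (n * t)) -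
        sinh (n * t) / n * m * (n / 2 * (1 / cosh (n * t)))) else 0) +
      if j = m then sinh (j * t) / j * (sinh (n * t) / n * m * (n / 2)) else 0 := by
    intro j hj
    rw [mem_range] at hj
    have e4 : ∑ k ∈ range n, sin (j * chebNode n t k) *
        (cos (m * chebNode n t k) + sinh (n * t) / n * (m * sin (m * chebNode n t k))) =
        ∑ k ∈ range n, sin (j * chebNode n t k) * cos (m * chebNode n t k) +
        sinh (n * t) / n * m * ∑ k ∈ range n, sin (j * chebNode n t k) *
          sin (m * chebNode n t k) := by
      rw [mul_sum, ← sum_add_distrib]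
      exact sum_congr rfl fun k _ => by ring
    rw [e4, sum_sin_mul_cos_chebNode hn ht.le hj hmn h0, sum_sin_mul_sin_chebNode hn t hj hmn h0]
    split_ifs <;> ring
  rw [sum_congr rfl e3, sum_add_distrib, sum_ite_eq', sum_ite_eq',
    if_pos (mem_range.2 hmn), if_pos (mem_range.2 (by omega))]
  have hm' : (0 : ℝ) < m := by positivity
  have hnm : (0 : ℝ) < n - m := by rw [sub_pos]; exact_mod_cast hmn
  rw [Nat.cast_sub hm, sub_mul, sinh_sub]
  field_simp
  ring

-- Each `T_d` has exact degree `d`, so subtracting a multiple of it removes the coefficient of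
-- degree `d`.
open Polynomial in
theorem Polynomial.linearMap_eq_zero_of_chebyshev_T {M : Type*} [AddCommGroup M] [Module ℂ M]
    (f : ℂ[X] →ₗ[ℂ] M) (n : ℕ) (hf : ∀ m < n, f (Chebyshev.T ℂ m) = 0) {P : ℂ[X]}
    (hP : P.degree < n) : f P = 0 := by
  induction n generalizing P with
  | zero =>
    rw [Nat.cast_zero, ← not_le, zero_le_degree_iff, not_not] at hP
    rw [hP, map_zero]
  | succ d ih =>
    have hT : (Chebyshev.T ℂ d).coeff d ≠ 0 := by
      have h := Chebyshev.natDegree_T ℂ d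
      rw [Int.natAbs_natCast] at h
      have h2 : (Chebyshev.T ℂ d).leadingCoeff ≠ 0 := by
        rw [Chebyshev.leadingCoeff_T]; exact pow_ne_zero _ two_ne_zero
      rwa [leadingCoeff, h] at h2
    set b := P.coeff d / (Chebyshev.T ℂ d).coeff d with hb
    have hQ : (P - b • Chebyshev.T ℂ d).degree < d := by
      rw [degree_lt_iff_coeff_zero] at hP ⊢
      intro m hm
      rw [coeff_sub, coeff_smul, smul_eq_mul]
      rcases hm.eq_or_lt with rfl | h
      · rw [hb, div_mul_cancel₀ _ hT, sub_self]
      · rw [hP m h, coeff_eq_zero_of_degree_lt, mul_zero, sub_zero]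
        rw [Chebyshev.degree_T]
        simpa using h
    have := ih (fun m hm => hf m (by omega)) hQ
    rwa [map_sub, map_smul, hf d (by omega), smul_zero, sub_zero] at this

open Real Finset Polynomial in
theorem eval_cosh_eq_sum_chebWeight {n : ℕ} (hn : n ≠ 0) {t : ℝ} (ht : 0 < t) {P : ℂ[X]}
    (hP : P.natDegree ≤ n) :
    P.eval ((cosh t : ℝ) : ℂ) = ∑ k ∈ range n, (chebWeight n t k : ℂ) *
      (P.eval ((cos (chebNode n t k) : ℝ) : ℂ) + ((sinh (n * t) / n * sin (chebNode n t k) : ℝ) : ℂ) *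
        P.derivative.eval ((cos (chebNode n t k) : ℝ) : ℂ)) := by
  let f : ℂ[X] →ₗ[ℂ] ℂ := leval ((cosh t : ℝ) : ℂ) - ∑ k ∈ range n, (chebWeight n t k : ℂ) •
    (leval ((cos (chebNode n t k) : ℝ) : ℂ) + ((sinh (n * t) / n * sin (chebNode n t k) : ℝ) : ℂ) •
      (leval ((cos (chebNode n t k) : ℝ) : ℂ)).comp derivative)
  have hf : ∀ Q, f Q = Q.eval ((cosh t : ℝ) : ℂ) - ∑ k ∈ range n, (chebWeight n t k : ℂ) *
      (Q.eval ((cos (chebNode n t k) : ℝ) : ℂ) + ((sinh (n * t) / n * sin (chebNode n t k) : ℝ) : ℂ) *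
        Q.derivative.eval ((cos (chebNode n t k) : ℝ) : ℂ)) := by
    intro Q
    simp [f, LinearMap.sum_apply, mul_add]
  have h0 : f P = 0 := by
    refine linearMap_eq_zero_of_chebyshev_T f (n + 1) (fun m hm => ?_)
      (lt_of_le_of_lt degree_le_natDegree (by exact_mod_cast Nat.lt_succ_of_le hP))
    rw [hf, sub_eq_zero, ← Chebyshev.complex_ofReal_eval_T, Chebyshev.T_real_cosh, Int.cast_natCast,
      ← sum_chebWeight_mul_cos_add_sin hn ht (Nat.le_of_lt_succ hm)]
    push_cast
    refine sum_congr rfl fun k _ => ?_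
    congr 2
    · rw [Chebyshev.T_complex_cos]; push_cast; rfl
    · rw [Chebyshev.T_derivative_eq_U, mul_assoc]
      congr 1
      have := Chebyshev.U_complex_cos (chebNode n t k : ℂ) ((m : ℤ) - 1)
      push_cast at this
      rw [sub_add_cancel] at this
      rw [← this, Int.cast_natCast, eval_mul, eval_natCast]
      ring
  rwa [hf, sub_eq_zero] at h0

/-! ### Constant phase, and exclusion of poles on the interval -/

/-- A multiple of a function with real logarithmic derivative on an interval is positive there. -/
theorem exists_pos_mul_of_deriv_eq_real_mul {f f' : ℝ → ℂ} {ρ : ℝ → ℝ} {x₀ b : ℝ}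
    (hb : x₀ < b) (hf : ∀ x, HasDerivAt f (f' x) x) (hne : ∀ x ∈ Set.Icc x₀ b, f x ≠ 0)
    (hρ : ∀ x ∈ Set.Icc x₀ b, f' x = ρ x * f x) {x : ℝ} (hx : x ∈ Set.Icc x₀ b) :
    ∃ r : ℝ, 0 < r ∧ starRingEnd ℂ (f x₀) * f x = r := by
  have hx₀ : x₀ ∈ Set.Icc x₀ b := Set.left_mem_Icc.2 hb.le
  have hconj : ∀ x, HasDerivAt (fun x => starRingEnd ℂ (f x)) (starRingEnd ℂ (f' x)) x :=
    fun x => (hf x).star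
  have hne' : ∀ x ∈ Set.Icc x₀ b, starRingEnd ℂ (f x) ≠ 0 := fun x hx =>
    (map_ne_zero _).2 (hne x hx)
  -- This quotient is the square of the phase of `f`; its logarithmic derivative is `ρ - ρ = 0`.
  have hconst : ∀ x ∈ Set.Icc x₀ b,
      f x / starRingEnd ℂ (f x) = f x₀ / starRingEnd ℂ (f x₀) := by
    refine constant_of_has_deriv_right_zero ?_ ?_
    · exact fun x hx => ((hf x).div (hconj x) (hne' x hx)).continuousAt.continuousWithinAt
    · intro x hx
      have hx' := Set.Ico_subset_Icc_self hx
      refine ((hf x).div (hconj x) (hne' x hx')).hasDerivWithinAt.congr_deriv ?_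
      rw [hρ x hx', map_mul, Complex.conj_ofReal]
      ring
  have hreal : ∀ x ∈ Set.Icc x₀ b,
      starRingEnd ℂ (f x₀) * f x = ((starRingEnd ℂ (f x₀) * f x).re : ℂ) := by
    intro x hx
    have h := hconst x hx
    rw [div_eq_div_iff (hne' x hx) (hne' x₀ hx₀)] at h
    refine (Complex.conj_eq_iff_re.1 ?_).symm
    rw [map_mul, Complex.conj_conj]
    linear_combination -h
  refine ⟨(starRingEnd ℂ (f x₀) * f x).re, ?_, hreal x hx⟩
  have hcont : ContinuousOn (fun x => (starRingEnd ℂ (f x₀) * f x).re) (Set.Icc x₀ b) := by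
    have : Continuous f := continuous_iff_continuousAt.2 fun x => (hf x).continuousAt
    exact (by fun_prop : Continuous _).continuousOn
  have hpos : 0 < (starRingEnd ℂ (f x₀) * f x₀).re := by
    rw [mul_comm, Complex.mul_conj, Complex.ofReal_re]
    exact Complex.normSq_pos.2 (hne x₀ hx₀)
  by_contra hle
  obtain ⟨y, hy, hy0⟩ := isPreconnected_Icc.intermediate_value hx hx₀ hcont ⟨not_lt.1 hle, hpos.le⟩
  have := hreal y hy
  rw [show (starRingEnd ℂ (f x₀) * f y).re = 0 from hy0, Complex.ofReal_zero] at this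
  exact mul_ne_zero (hne' x₀ hx₀) (hne y hy) this

open Filter Topology in
/-- The residue of a logarithmic derivative at `w` is the multiplicity of `w`. -/
theorem tendsto_sub_mul_logDerivOfPoles (Z : Multiset ℂ) (w : ℂ) :
    Tendsto (fun z => (z - w) * logDerivOfPoles Z z) (𝓝[≠] w) (𝓝 (Z.count w : ℂ)) := by
  induction Z using Multiset.induction with
  | empty => simp [logDerivOfPoles]
  | cons b Z ih =>
    have e : (fun z => (z - w) * logDerivOfPoles (b ::ₘ Z) z) =
        fun z => (z - w) * (1 / (z - b)) + (z - w) * logDerivOfPoles Z z := by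
      funext z
      simp [logDerivOfPoles, mul_add]
    rw [e, Multiset.count_cons, Nat.cast_add, add_comm (_ : ℂ)]
    refine Tendsto.add ?_ ih
    split_ifs with h
    · subst h
      rw [Nat.cast_one]
      refine tendsto_const_nhds.congr' ?_
      filter_upwards [self_mem_nhdsWithin] with z hz
      rw [mul_one_div_cancel (sub_ne_zero.2 hz)]
    · have hc : ContinuousAt (fun z => (z - w) * (1 / (z - b))) w := by
        have : w - b ≠ 0 := sub_ne_zero.2 h
        fun_prop (disch := assumption)
      simpa using hc.tendsto.mono_left nhdsWithin_le_nhds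

-- Even at an endpoint the weight vanishes only like a square root, too slowly to cancel a simple
-- pole. Boundedness would give `|x - w| |ρ x| ≤ M √|x - w| → 0`, whereas the left side tends to the
-- multiplicity of `w`.
open Filter Topology in
theorem not_bounded_of_pole {Z : Multiset ℂ} {ρ : ℝ → ℝ} {M w : ℝ} (hw : (w : ℂ) ∈ Z)
    (hρ : ∀ x : ℝ, (x : ℂ) ∉ Z → (ρ x : ℂ) = logDerivOfPoles Z (x : ℂ)) {l : Filter ℝ} [l.NeBot]
    (hl : l ≤ 𝓝[≠] w) (hx : ∀ᶠ x in l, |x - w| ≤ 1 - x ^ 2) :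
    ¬ ∀ᶠ x in l, |√(1 - x ^ 2) * ρ x| ≤ M := by
  intro hM
  have hZ : ∀ᶠ x : ℝ in l, (x : ℂ) ∉ Z := by
    have : ∀ᶠ z : ℂ in 𝓝[≠] (w : ℂ), z ∉ Z := by
      have h : (Z.toFinset.erase (w : ℂ) : Set ℂ)ᶜ ∈ 𝓝 (w : ℂ) :=
        (Z.toFinset.erase (w : ℂ)).finite_toSet.isClosed.isOpen_compl.mem_nhds (by simp)
      filter_upwards [mem_nhdsWithin_of_mem_nhds h, self_mem_nhdsWithin] with z h1 h2 h3
      exact h1 (by simpa using ⟨h3, h2⟩)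
    have ht : Tendsto (fun x : ℝ => (x : ℂ)) (𝓝[≠] w) (𝓝[≠] (w : ℂ)) :=
      tendsto_nhdsWithin_of_tendsto_nhds_of_eventually_within _
        (Complex.continuous_ofReal.continuousAt.tendsto.mono_left nhdsWithin_le_nhds)
        (by filter_upwards [self_mem_nhdsWithin] with x hx; simpa using hx)
    exact (ht.eventually this).filter_mono hl
  have ht : Tendsto (fun x : ℝ => (x : ℂ)) l (𝓝[≠] (w : ℂ)) :=
    (tendsto_nhdsWithin_of_tendsto_nhds_of_eventually_within _
      (Complex.continuous_ofReal.continuousAt.tendsto.mono_left nhdsWithin_le_nhds)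
      (by filter_upwards [self_mem_nhdsWithin] with x hx; simpa using hx)).mono_left hl
  have h1 := ((tendsto_sub_mul_logDerivOfPoles Z w).comp ht).norm
  have hlim : Tendsto (fun x : ℝ => M * √|x - w|) l (𝓝 0) := by
    have : ContinuousAt (fun x : ℝ => M * √|x - w|) w := by fun_prop
    simpa using this.tendsto.mono_left (hl.trans nhdsWithin_le_nhds)
  have hle := le_of_tendsto_of_tendsto h1 hlim ?_
  · have : 0 < Z.count (w : ℂ) := Multiset.count_pos.2 hw
    rw [Complex.norm_natCast] at hle
    have : (0 : ℝ) < Z.count (w : ℂ) := by exact_mod_cast this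
    linarith
  · filter_upwards [hM, hx, hZ] with x hMx hxx hZx
    simp only [Function.comp]
    rw [← hρ x hZx, ← Complex.ofReal_sub, ← Complex.ofReal_mul, Complex.norm_real,
      Real.norm_eq_abs, abs_mul]
    have hs : √|x - w| ≤ √(1 - x ^ 2) := Real.sqrt_le_sqrt hxx
    rw [abs_mul, abs_of_nonneg (Real.sqrt_nonneg _)] at hMx
    calc |x - w| * |ρ x| = √|x - w| * (√|x - w| * |ρ x|) := by
          rw [← mul_assoc, Real.mul_self_sqrt (abs_nonneg _)]
      _ ≤ √|x - w| * (√(1 - x ^ 2) * |ρ x|) := by gcongr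
      _ ≤ √|x - w| * M := by gcongr
      _ = M * √|x - w| := mul_comm _ _

open Filter Topology in
/-- A logarithmic derivative of finite weighted norm has no pole on `[-1, 1]`. -/
theorem notMem_of_forall_abs_le {Z : Multiset ℂ} {ρ : ℝ → ℝ} {M : ℝ}
    (hρ : ∀ x : ℝ, (x : ℂ) ∉ Z → (ρ x : ℂ) = logDerivOfPoles Z (x : ℂ))
    (hM : ∀ x ∈ Set.Icc (-1 : ℝ) 1, |√(1 - x ^ 2) * ρ x| ≤ M) {w : ℝ}
    (hw : w ∈ Set.Icc (-1 : ℝ) 1) : (w : ℂ) ∉ Z := by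
  intro hwZ
  obtain ⟨hw1, hw2⟩ := hw
  rcases le_or_gt w 0 with h | h
  -- The pole is approached from the side of the origin: this stays inside the interval even when
  -- `w` is an endpoint, and within distance `1/2` it ensures `|x - w| ≤ 1 - x ^ 2`.
  · have hev : ∀ᶠ x in 𝓝[>] w, w < x ∧ x < w + 1 / 2 := by
      exact Ioo_mem_nhdsGT (by linarith)
    refine not_bounded_of_pole hwZ hρ (l := 𝓝[>] w)
      (nhdsWithin_mono _ fun x hx => ne_of_gt hx) ?_ (M := M) ?_
    · filter_upwards [hev] with x hx
      rw [abs_of_pos (by linarith [hx.1])]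
      nlinarith [hx.1, hx.2]
    · filter_upwards [hev] with x hx
      exact hM x ⟨by linarith [hx.1], by linarith [hx.2]⟩
  · have hev : ∀ᶠ x in 𝓝[<] w, w - 1 / 2 < x ∧ x < w := by
      exact Ioo_mem_nhdsLT (by linarith)
    refine not_bounded_of_pole hwZ hρ (l := 𝓝[<] w)
      (nhdsWithin_mono _ fun x hx => ne_of_lt hx) ?_ (M := M) ?_
    · filter_upwards [hev] with x hx
      rw [abs_of_neg (by linarith [hx.2])]
      nlinarith [hx.1, hx.2]
    · filter_upwards [hev] with x hx
      exact hM x ⟨by linarith [hx.1], by linarith [hx.2]⟩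

/-! ### The lower bound for an arbitrary logarithmic derivative -/

open Real Finset Polynomial in
theorem exists_le_abs_sqrt_mul_of_pole {n : ℕ} (hn : n ≠ 0) {t : ℝ} (ht : 0 ≤ t) (hs : 1 ≤ sinh t)
    {Z : Multiset ℂ} (hcard : Z.card ≤ n) (ha : ((cosh t : ℝ) : ℂ) ∈ Z) {ρ : ℝ → ℝ}
    (hZ : ∀ x ∈ Set.Icc (-1 : ℝ) 1, (x : ℂ) ∉ Z)
    (hρ : ∀ x : ℝ, (x : ℂ) ∉ Z → (ρ x : ℂ) = logDerivOfPoles Z (x : ℂ)) :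
    ∃ x ∈ Set.Icc (-1 : ℝ) 1, n / sinh (n * t) ≤ |√(1 - x ^ 2) * ρ x| := by
  by_contra! hlt
  have ht0 : 0 < t := ht.lt_of_ne (by rintro rfl; simp at hs; linarith)
  have hn' : (0 : ℝ) < n := by positivity
  have hS : 0 < sinh (n * t) := sinh_pos_iff.2 (by positivity)
  set P : ℂ[X] := (Z.map fun w => X - C w).prod with hP
  have hroots : P.roots = Z := roots_multiset_prod_X_sub_C Z
  have hP0 : P ≠ 0 := (monic_multisetProd_X_sub_C Z).ne_zero
  have hev : ∀ z, z ∉ Z → P.eval z ≠ 0 := fun z hz h =>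
    hz (hroots ▸ (mem_roots hP0).2 h)
  have hdeg : P.natDegree ≤ n := by rwa [hP, natDegree_multiset_prod_X_sub_C_eq_card]
  have hd : ∀ x ∈ Set.Icc (-1 : ℝ) 1, P.derivative.eval (x : ℂ) = ρ x * P.eval (x : ℂ) := by
    intro x hx
    rw [hρ x (hZ x hx), logDerivOfPoles_eq Z _ (hZ x hx), ← hP,
      div_mul_cancel₀ _ (hev _ (hZ x hx))]
  have hpos : ∀ x ∈ Set.Icc (-1 : ℝ) 1, ∃ r : ℝ, 0 < r ∧
      starRingEnd ℂ (P.eval ((-1 : ℝ) : ℂ)) * P.eval (x : ℂ) = r := fun x hx =>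
    exists_pos_mul_of_deriv_eq_real_mul (f := fun x : ℝ => P.eval (x : ℂ)) (by norm_num)
      (fun x => (P.hasDerivAt (x : ℂ)).comp_ofReal) (fun x hx => hev _ (hZ x hx)) hd hx
  have hmem : ∀ k, cos (chebNode n t k) ∈ Set.Icc (-1 : ℝ) 1 := fun k =>
    ⟨neg_one_le_cos _, cos_le_one _⟩
  choose r hr0 hr using fun k => hpos _ (hmem k)
  have hfac : ∀ k, 0 < 1 + sinh (n * t) / n * sin (chebNode n t k) * ρ (cos (chebNode n t k)) := by
    intro k
    have h := hlt _ (hmem k)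
    rw [← sin_sq, sqrt_sq_eq_abs, abs_mul, abs_abs, ← abs_mul, lt_div_iff₀ hS] at h
    have h2 := neg_abs_le (sin (chebNode n t k) * ρ (cos (chebNode n t k)))
    have h3 : 0 < n + sinh (n * t) * (sin (chebNode n t k) * ρ (cos (chebNode n t k))) := by
      nlinarith
    have := div_pos h3 hn'
    rw [add_div, div_self hn'.ne'] at this
    rwa [mul_div_right_comm, ← mul_assoc] at this
  have hq := eval_cosh_eq_sum_chebWeight hn ht0 hdeg
  have h0 : P.eval ((cosh t : ℝ) : ℂ) = 0 := by
    rw [← hroots] at ha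
    exact (mem_roots hP0).1 ha
  -- The quadrature formula at the root `cosh t`, multiplied by the conjugate of `P(-1)` to make all
  -- node values positive reals.
  have hsum : ∑ k ∈ range n, chebWeight n t k * (r k *
      (1 + sinh (n * t) / n * sin (chebNode n t k) * ρ (cos (chebNode n t k)))) = 0 := by
    rw [h0] at hq
    have h1 := congrArg (starRingEnd ℂ (P.eval ((-1 : ℝ) : ℂ)) * ·) hq
    simp only [mul_zero, mul_sum] at h1
    rw [← Complex.ofReal_inj, Complex.ofReal_zero, h1, Complex.ofReal_sum]
    refine sum_congr rfl fun k _ => ?_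
    rw [hd _ (hmem k), Complex.ofReal_mul (chebWeight n t k), Complex.ofReal_mul (r k), ← hr k]
    push_cast
    ring
  have hz := (sum_eq_zero_iff_of_nonneg fun k hk => mul_nonneg
    (chebWeight_nonneg hn ht hs (mem_range.1 hk)) (mul_pos (hr0 k) (hfac k)).le).1 hsum
  -- A vanishing sum of nonnegative terms would make every weight zero, but the weights add up to
  -- `1`.
  have hone := sum_chebWeight_mul_const hn t 1
  rw [sum_eq_zero fun k hk => by
    rw [(mul_eq_zero.1 (hz k hk)).resolve_right (mul_pos (hr0 k) (hfac k)).ne', zero_mul]] at hone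
  exact zero_ne_one hone

/-! ### The extremal function: membership, norm and conclusion -/

open Polynomial in
theorem integral_chebyshev_U {n : ℕ} (hn : n ≠ 0) (a x : ℝ) :
    ∫ t in a..x, (Chebyshev.U ℝ ((n : ℤ) - 1)).eval t =
      ((Chebyshev.T ℝ (n : ℤ)).eval x - (Chebyshev.T ℝ (n : ℤ)).eval a) / n := by
  have hn' : (n : ℝ) ≠ 0 := by exact_mod_cast hn
  have h : ∀ y ∈ Set.uIcc a x, HasDerivAt (fun y => (Chebyshev.T ℝ (n : ℤ)).eval y / n)
      ((Chebyshev.U ℝ ((n : ℤ) - 1)).eval y) y := by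
    intro y _
    refine (((Chebyshev.T ℝ (n : ℤ)).hasDerivAt y).div_const (n : ℝ)).congr_deriv ?_
    rw [Chebyshev.T_derivative_eq_U, Int.cast_natCast, eval_mul, eval_natCast,
      mul_div_cancel_left₀ _ hn']
  rw [intervalIntegral.integral_eq_sub_of_hasDerivAt h
    ((Polynomial.continuous _).intervalIntegrable _ _), sub_div]

open Polynomial in
theorem extremalLogDeriv_mem_realLogDerivs {n : ℕ} (hn : n ≠ 0) (a : ℝ) :
    extremalLogDeriv n a ∈ realLogDerivs n a := by
  set b := (Chebyshev.T ℝ (n : ℤ)).eval a with hb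
  set P : ℂ[X] := Chebyshev.T ℂ (n : ℤ) - C (b : ℂ) with hP
  have hdT : (Chebyshev.T ℂ (n : ℤ)).natDegree = n := by rw [Chebyshev.natDegree_T]; simp
  have hdeg : P.natDegree = n := by rw [hP, natDegree_sub_C, hdT]
  have hP0 : P ≠ 0 := by
    rintro h
    rw [h, natDegree_zero] at hdeg
    exact hn hdeg.symm
  have hev : ∀ x : ℝ, P.eval (x : ℂ) = (((Chebyshev.T ℝ (n : ℤ)).eval x - b : ℝ) : ℂ) := by
    intro x
    rw [hP, eval_sub, eval_C, Complex.ofReal_sub, Chebyshev.complex_ofReal_eval_T x]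
  refine ⟨P.roots, (card_roots' P).trans hdeg.le, ?_, fun x hx => ?_⟩
  · rw [mem_roots hP0, IsRoot, hev, hb, sub_self, Complex.ofReal_zero]
  · have hx0 : P.eval (x : ℂ) ≠ 0 := fun h => hx ((mem_roots hP0).2 h)
    have h := Polynomial.Splits.eval_derivative_div_eval_of_ne_zero (IsAlgClosed.splits P) hx0
    rw [logDerivOfPoles, ← h, hev, hP, derivative_sub, derivative_C, sub_zero,
      Chebyshev.T_derivative_eq_U, Int.cast_natCast, eval_mul, eval_natCast, extremalLogDeriv,
      Complex.ofReal_div, Complex.ofReal_mul, Complex.ofReal_natCast,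
      Chebyshev.complex_ofReal_eval_U]

open Real Polynomial in
theorem abs_sqrt_mul_extremalLogDeriv_cos (n : ℕ) (t θ : ℝ) :
    |√(1 - cos θ ^ 2) * extremalLogDeriv n (cosh t) (cos θ)| =
      n * |sin (n * θ)| / |cosh (n * t) - cos (n * θ)| := by
  have h := Chebyshev.U_real_cos θ ((n : ℤ) - 1)
  push_cast at h
  rw [sub_add_cancel] at h
  rw [extremalLogDeriv, Chebyshev.T_real_cos, Chebyshev.T_real_cosh, ← sin_sq, sqrt_sq_eq_abs,
    abs_mul, abs_abs, abs_div, abs_mul, Nat.abs_cast, ← h, abs_mul, Int.cast_natCast, abs_sub_comm]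
  ring

open Real in
theorem isGreatest_abs_sqrt_mul_extremalLogDeriv {n : ℕ} (hn : n ≠ 0) {t : ℝ} (ht : 0 < t) :
    IsGreatest ((fun x : ℝ => |√(1 - x ^ 2) * extremalLogDeriv n (cosh t) x|) '' Set.Icc (-1) 1)
      (n / sinh (n * t)) := by
  have hn' : (0 : ℝ) < n := by positivity
  have hS : 0 < sinh (n * t) := sinh_pos_iff.2 (by positivity)
  have hc := cosh_pos (n * t)
  have hsq := cosh_sq (n * t)
  constructor
  · refine ⟨cos (chebNode n t 0), ⟨neg_one_le_cos _, cos_le_one _⟩, ?_⟩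
    have h1 : cos (n * chebNode n t 0) = 1 / cosh (n * t) :=
      eq_div_of_mul_eq hc.ne' (by rw [mul_comm]; exact cosh_mul_cos_chebNode hn t 0)
    have h2 : sin (n * chebNode n t 0) = sinh (n * t) / cosh (n * t) :=
      eq_div_of_mul_eq hc.ne' (by rw [mul_comm]; exact cosh_mul_sin_chebNode hn ht.le 0)
    have h3 : cosh (n * t) - 1 / cosh (n * t) = sinh (n * t) ^ 2 / cosh (n * t) := by
      rw [eq_div_iff hc.ne', sub_mul, div_mul_cancel₀ _ hc.ne']
      linarith
    simp only []
    rw [abs_sqrt_mul_extremalLogDeriv_cos, h1, h2, h3, abs_of_pos (by positivity),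
      abs_of_pos (by positivity)]
    field_simp
  · rintro _ ⟨x, ⟨hx1, hx2⟩, rfl⟩
    simp only []
    rw [← cos_arccos hx1 hx2, abs_sqrt_mul_extremalLogDeriv_cos]
    set θ := n * arccos x
    have hD : 0 < cosh (n * t) - cos θ := by
      linarith [one_lt_cosh.2 (by positivity : n * t ≠ 0), cos_le_one θ]
    rw [abs_of_pos hD, div_le_div_iff₀ hD hS, mul_assoc]
    refine mul_le_mul_of_nonneg_left (abs_le_of_sq_le_sq' ?_ hD.le).2 hn'.le
    rw [mul_pow, sq_abs, sin_sq]
    -- With `c = cosh (nt)`, `(c - cos θ)² - (1 - cos² θ)(c² - 1) = (c cos θ - 1)²`; equality holds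
    -- exactly when `cos θ = 1 / c`, as at the nodes.
    nlinarith [sq_nonneg (cosh (n * t) * cos θ - 1)]

theorem weightedNorm_eq_of_isGreatest {ρ : ℝ → ℝ} {M : ℝ}
    (h : IsGreatest ((fun x : ℝ => |√(1 - x ^ 2) * ρ x|) '' Set.Icc (-1) 1) M) :
    weightedNorm ρ = ENNReal.ofReal M := by
  obtain ⟨⟨x, hx, rfl⟩, hM⟩ := h
  refine le_antisymm (iSup₂_le fun y hy => ENNReal.ofReal_le_ofReal (hM ⟨y, hy, rfl⟩)) ?_
  exact le_iSup₂ (f := fun y (_ : y ∈ Set.Icc (-1 : ℝ) 1) => ENNReal.ofReal |√(1 - y ^ 2) * ρ y|)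
    x hx

open Real in
theorem ofReal_le_weightedNorm {n : ℕ} (hn : n ≠ 0) {t : ℝ} (ht : 0 ≤ t) (hs : 1 ≤ sinh t)
    {ρ : ℝ → ℝ} (hρ : ρ ∈ realLogDerivs n (cosh t)) :
    ENNReal.ofReal (n / sinh (n * t)) ≤ weightedNorm ρ := by
  obtain ⟨Z, hcard, ha, hZ⟩ := hρ
  have hle : ∀ x ∈ Set.Icc (-1 : ℝ) 1, ENNReal.ofReal |√(1 - x ^ 2) * ρ x| ≤ weightedNorm ρ :=
    fun x hx => le_iSup₂
      (f := fun y (_ : y ∈ Set.Icc (-1 : ℝ) 1) => ENNReal.ofReal |√(1 - y ^ 2) * ρ y|) x hx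
  rcases eq_or_ne (weightedNorm ρ) ⊤ with htop | htop
  · rw [htop]; exact le_top
  have hM : ∀ x ∈ Set.Icc (-1 : ℝ) 1, |√(1 - x ^ 2) * ρ x| ≤ (weightedNorm ρ).toReal :=
    fun x hx => (ENNReal.ofReal_le_iff_le_toReal htop).1 (hle x hx)
  obtain ⟨x, hx, h⟩ := exists_le_abs_sqrt_mul_of_pole hn ht hs hcard ha
    (fun x hx => notMem_of_forall_abs_le hZ hM hx) hZ
  exact (ENNReal.ofReal_le_ofReal h).trans (hle x hx)

theorem mainTheorem1 (n : ℕ) (hn : 1 ≤ n) (a : ℝ) (ha : √2 < a) :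
    (∀ x : ℝ, extremalLogDeriv n a x =
      (Polynomial.Chebyshev.U ℝ ((n : ℤ) - 1)).eval x /
        ∫ t in a..x, (Polynomial.Chebyshev.U ℝ ((n : ℤ) - 1)).eval t) ∧
    extremalLogDeriv n a ∈ realLogDerivs n a ∧
    (∀ ρ ∈ realLogDerivs n a, weightedNorm (extremalLogDeriv n a) ≤ weightedNorm ρ) ∧
    weightedNorm (extremalLogDeriv n a) =
      ENNReal.ofReal (n / √((Polynomial.Chebyshev.T ℝ (n : ℤ)).eval a ^ 2 - 1)) ∧
    IsGreatest ((fun x : ℝ => |√(1 - x ^ 2) * extremalLogDeriv n a x|) '' Set.Icc (-1) 1)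
      (n / √((Polynomial.Chebyshev.T ℝ (n : ℤ)).eval a ^ 2 - 1)) := by
  have hn0 : n ≠ 0 := by omega
  have h2 : 2 ≤ a ^ 2 := by
    have := Real.sq_sqrt (show (0 : ℝ) ≤ 2 by norm_num)
    nlinarith [Real.sqrt_nonneg 2]
  have ha1 : 1 ≤ a := by nlinarith [Real.sqrt_nonneg 2]
  -- Since `sinh² t = a² - 1`, the condition `1 ≤ sinh t` amounts to `2 ≤ a²`.
  obtain ⟨t, ht, hs, rfl⟩ : ∃ t, 0 < t ∧ 1 ≤ Real.sinh t ∧ Real.cosh t = a := by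
    have hs : 1 ≤ Real.sinh (Real.arcosh a) := by
      rw [Real.sinh_arcosh ha1, Real.one_le_sqrt]
      linarith
    exact ⟨Real.arcosh a, Real.sinh_pos_iff.1 (by linarith), hs, Real.cosh_arcosh ha1⟩
  have hS : √((Polynomial.Chebyshev.T ℝ (n : ℤ)).eval (Real.cosh t) ^ 2 - 1) =
      Real.sinh (n * t) := by
    rw [Polynomial.Chebyshev.T_real_cosh, Int.cast_natCast, ← Real.sinh_sq,
      Real.sqrt_sq (Real.sinh_nonneg_iff.2 (by positivity))]
  have hmax := isGreatest_abs_sqrt_mul_extremalLogDeriv hn0 ht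
  have hnorm := weightedNorm_eq_of_isGreatest hmax
  rw [hS]
  refine ⟨fun x => ?_, extremalLogDeriv_mem_realLogDerivs hn0 _, fun ρ hρ => ?_, hnorm, hmax⟩
  · rw [integral_chebyshev_U hn0, extremalLogDeriv, div_div_eq_mul_div, mul_comm]
  · rw [hnorm]
    exact ofReal_le_weightedNorm hn0 ht.le hs hρ
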